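/- Let $X,Y,Z$ be the Pauli matrices, $\vec\sigma=(X,Y,Z)$, and $\hat n_\epsilon=(\epsilon,0,1)/\sqrt{1+\epsilon^2}$. An unknown single-qubit Hamiltonian $H$ is promised to be either $Z$ or $\hat n_\epsilon\cdot\vec\sigma$, and one has to decide which. A \emph{single experiment} prepares a pure state $|\psi_0\rangle$ of $N\ge 1$ qubits, applies $$U_{m+1}\bigl(e^{-it_m(H+\nu_mP_m)}\otimes I\bigr)U_m\cdots\bigl(e^{-it_1(H+\nu_1P_1)}\otimes I\bigr)U_1 ,$$ and measures a POVM with finitely many outcomes. Here $m\ge 0$ is an integer, $t_j\ge 0$, the $U_j$ are arbitrary $N$-qubit unitaries, and each $P_j$ is a traceless single-qubit Hermitian operator with eigenvalues $\pm1$ (the direction of a static field of strength $\nu_j\ge 0$). The experiment uses evolution time $\sum_j t_j$ and $m$ applications of the Hamiltonian. An \emph{adaptive protocol} is a finite rooted tree: at each internal node it runs an experiment (depending on the node), whose outcome selects the child; at each leaf it stops and announces a guess. The protocol has field strength at most $\nu$ if all $\nu_j\le\nu$ throughout the tree, and it uses at most $L$ applications of the Hamiltonian if on every root-to-leaf path the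 total number of applications is at most $L$. \textbf{Theorem S6.} For every $q>\tfrac12$ there is a constant $c>0$, depending only on $q$, such that the following holds. Let $L(\epsilon)\in\mathbb N$ satisfy $L(\epsilon)=o(1/\epsilon)$ as $\epsilon\to0^+$. Then for all sufficiently small $\epsilon>0$, all $\nu$ with $0\le\nu<1$, and every adaptive protocol that has field strength at most $\nu$, uses at most $L(\epsilon)$ applications of the Hamiltonian, and announces the correct Hamiltonian with probability at least $q$ whichever of $Z$, $\hat n_\epsilon\cdot\vec\sigma$ is the true one, the expected total evolution time $T$ of the protocol satisfies $$T\ \ge\ \frac{c}{4\nu\epsilon+3\epsilon^2}$$ under each of the two Hamiltonians; that is, $T=\Omega\bigl(\tfrac{1}{4\nu\epsilon+3\epsilon^2}\bigr)$. -/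

import Mathlib

open Filter Topology Asymptotics
open scoped Matrix Kronecker ComplexOrder

namespace HamiltonianDiscrimination

noncomputable section

/-- The Pauli matrix `X`. -/
def pauliX : Matrix (Fin 2) (Fin 2) ℂ := !![0, 1; 1, 0]

/-- The Pauli matrix `Y`. -/
def pauliY : Matrix (Fin 2) (Fin 2) ℂ := !![0, -Complex.I; Complex.I, 0]

/-- The Pauli matrix `Z`. -/
def pauliZ : Matrix (Fin 2) (Fin 2) ℂ := !![1, 0; 0, -1]

/-- `n · σ = n₁ X + n₂ Y + n₃ Z`. -/
def pauliDot (n : Fin 3 → ℝ) : Matrix (Fin 2) (Fin 2) ℂ :=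
  (n 0 : ℂ) • pauliX + (n 1 : ℂ) • pauliY + (n 2 : ℂ) • pauliZ

/-- The unit vector `(ε, 0, 1) / √(1 + ε²)`. -/
def nHat (ε : ℝ) : Fin 3 → ℝ := (Real.sqrt (1 + ε ^ 2))⁻¹ • ![ε, 0, 1]

/-- The two candidate Hamiltonians: `false` labels `Z`, `true` labels `n̂ · σ`. -/
def candidate (ε : ℝ) : Bool → Matrix (Fin 2) (Fin 2) ℂ
  | false => pauliZ
  | true => pauliDot (nHat ε)

/-- Computational basis of the probed qubit together with `n` ancilla qubits
(an `N`-qubit system with `N = n + 1 ≥ 1`). -/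
abbrev Register (n : ℕ) : Type := Fin 2 × (Fin n → Fin 2)

/-- One application of the unknown Hamiltonian in a static field, followed by an
arbitrary unitary on the whole register. The conditions on `direction` say that it is a
traceless Hermitian operator with eigenvalues `1` and `-1`. -/
structure Segment (n : ℕ) where
  time : ℝ
  time_nonneg : 0 ≤ time
  strength : ℝ
  strength_nonneg : 0 ≤ strength
  direction : Matrix (Fin 2) (Fin 2) ℂ
  direction_isHermitian : direction.IsHermitian
  direction_trace : direction.trace = 0
  direction_sq : direction * direction = 1
  gate : Matrix.unitaryGroup (Register n) ℂ

/-- `U (exp(-i t (H + ν P)) ⊗ I)`, the Hamiltonian acting on the first qubit. -/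
def Segment.op {n : ℕ} (s : Segment n) (H : Matrix (Fin 2) (Fin 2) ℂ) :
    Matrix (Register n) (Register n) ℂ :=
  (s.gate : Matrix (Register n) (Register n) ℂ) *
    (NormedSpace.exp ((-(Complex.I * (s.time : ℂ))) • (H + (s.strength : ℂ) • s.direction)) ⊗ₖ
      (1 : Matrix (Fin n → Fin 2) (Fin n → Fin 2) ℂ))

/-- A single experiment: a pure initial state, an initial unitary, finitely many
applications of the unknown Hamiltonian (each followed by a unitary, in chronological
order), and a final POVM with finitely many outcomes. -/
structure Experiment where
  ancillas : ℕ
  state : Register ancillas → ℂ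
  state_unit : ∑ x, ‖state x‖ ^ 2 = 1
  initialGate : Matrix.unitaryGroup (Register ancillas) ℂ
  segments : List (Segment ancillas)
  outcomes : ℕ
  povm : Fin outcomes → Matrix (Register ancillas) (Register ancillas) ℂ
  povm_posSemidef : ∀ i, (povm i).PosSemidef
  povm_sum : ∑ i, povm i = 1

namespace Experiment

/-- The unitary `U_{L+1} (e^{-i t_L (H + ν_L P_L)} ⊗ I) U_L ⋯ (e^{-i t_1 (H + ν_1 P_1)} ⊗ I) U_1`. -/
def evolution (E : Experiment) (H : Matrix (Fin 2) (Fin 2) ℂ) :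
    Matrix (Register E.ancillas) (Register E.ancillas) ℂ :=
  E.segments.foldl (fun V s => s.op H * V)
    (E.initialGate : Matrix (Register E.ancillas) (Register E.ancillas) ℂ)

/-- The state just before the measurement. -/
def finalState (E : Experiment) (H : Matrix (Fin 2) (Fin 2) ℂ) : Register E.ancillas → ℂ :=
  E.evolution H *ᵥ E.state

/-- Born rule: the probability `⟨ψ| M_i |ψ⟩` of outcome `i` when the Hamiltonian is `H`. -/
def prob (E : Experiment) (H : Matrix (Fin 2) (Fin 2) ℂ) (i : Fin E.outcomes) : ℝ :=
  (star (E.finalState H) ⬝ᵥ (E.povm i *ᵥ E.finalState H)).re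

/-- Total time for which the unknown Hamiltonian is evolved in the experiment. -/
def totalTime (E : Experiment) : ℝ := (E.segments.map Segment.time).sum

/-- Number of applications of the unknown Hamiltonian in the experiment. -/
def applications (E : Experiment) : ℕ := E.segments.length

end Experiment

/-- An adaptive protocol: a finite rooted tree. At an internal node an experiment is run and
its outcome selects the child; at a leaf the protocol stops and announces a guess. -/
inductive Protocol : Type
  | leaf (guess : Bool) : Protocol
  | node (E : Experiment) (next : Fin E.outcomes → Protocol) : Protocol

namespace Protocol

/-- Every static field used anywhere in the tree has strength at most `ν`. -/
def FieldAtMost (ν : ℝ) : Protocol → Prop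
  | leaf _ => True
  | node E next => (∀ s ∈ E.segments, s.strength ≤ ν) ∧ ∀ i, FieldAtMost ν (next i)

/-- The maximum over all root-to-leaf paths of the number of applications of the unknown
Hamiltonian. -/
def maxApplications : Protocol → ℕ
  | leaf _ => 0
  | node E next => E.applications + Finset.univ.sup fun i => maxApplications (next i)

/-- The probability that the protocol announces the guess `b` when the Hamiltonian is `H`. -/
def guessProb (H : Matrix (Fin 2) (Fin 2) ℂ) (b : Bool) : Protocol → ℝ
  | leaf g => if g = b then 1 else 0
  | node E next => ∑ i, E.prob H i * guessProb H b (next i)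

/-- The expected total evolution time when the Hamiltonian is `H`. -/
def expectedTime (H : Matrix (Fin 2) (Fin 2) ℂ) : Protocol → ℝ
  | leaf _ => 0
  | node E next => E.totalTime + ∑ i, E.prob H i * expectedTime H (next i)

end Protocol

end

end HamiltonianDiscrimination

namespace HamiltonianDiscrimination

open NormedSpace

/-! ### Perturbation bounds for unitary one-parameter groups in a C*-algebra. -/

section CStar

variable {𝒜 : Type*} [CStarAlgebra 𝒜]

/-! Without a field both candidates rotate the Bloch sphere at the same speed, about axes at
distance at most `ε`, so one application separates them by `O(ε)` however long it runs. A field of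
strength `ν` shifts the two frequencies apart by `O(νε)`, and only this gap accumulates with time:
`norm_exp_clifford_field_sub_le` bounds one application by `(4 + 2νt)ε`. Unitarity makes these
errors add up along an experiment, and a hybrid argument over the tree
(`Protocol.abs_guessProb_sub_le`) bounds the gap in guess probabilities by `8ε` times the number of
applications plus `4νε` times the expected time. Success under both candidates forces a gap of at
least `2q - 1`; since `L = o(1/ε)`, the time term must supply half of it. -/

lemma norm_le_one_of_mem_unitary {u : 𝒜} (hu : u ∈ unitary 𝒜) : ‖u‖ ≤ 1 := by
  rcases subsingleton_or_nontrivial 𝒜 with h | h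
  · simp [Subsingleton.elim u 0]
  · exact (CStarRing.norm_of_mem_unitary hu).le

lemma norm_exp_le_one_of_mem_skewAdjoint {x : 𝒜} (hx : x ∈ skewAdjoint 𝒜) : ‖exp x‖ ≤ 1 :=
  letI := NormedAlgebra.restrictScalars ℚ ℂ 𝒜
  norm_le_one_of_mem_unitary (exp_mem_unitary_of_mem_skewAdjoint hx)

/-- Duhamel's bound for exponentials of skew-adjoint elements. -/
lemma norm_exp_sub_exp_le_of_mem_skewAdjoint {x y : 𝒜} (hx : x ∈ skewAdjoint 𝒜)
    (hy : y ∈ skewAdjoint 𝒜) : ‖exp x - exp y‖ ≤ ‖x - y‖ := by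
  -- A path from `exp y` to `exp x` whose derivative is `x - y` between two contractions.
  let f : ℝ → 𝒜 := fun s => exp (s • x) * exp ((1 - s) • y)
  have hd : ∀ s : ℝ, HasDerivAt f (exp (s • x) * (x - y) * exp ((1 - s) • y)) s := by
    intro s
    have h1 := hasDerivAt_exp_smul_const x s
    have h2 := (hasDerivAt_exp_smul_const' y (1 - s)).scomp s
      ((hasDerivAt_id s).const_sub (1 : ℝ))
    refine (h1.mul h2).congr_deriv ?_
    rw [neg_one_smul]
    simp only [Function.comp]
    noncomm_ring
  have hb : ∀ s ∈ Set.Ico (0 : ℝ) 1,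
      ‖exp (s • x) * (x - y) * exp ((1 - s) • y)‖ ≤ ‖x - y‖ := by
    intro s _
    have e1 := norm_exp_le_one_of_mem_skewAdjoint (skewAdjoint.smul_mem s hx)
    have e2 := norm_exp_le_one_of_mem_skewAdjoint (skewAdjoint.smul_mem (1 - s) hy)
    calc ‖exp (s • x) * (x - y) * exp ((1 - s) • y)‖
        ≤ ‖exp (s • x)‖ * ‖x - y‖ * ‖exp ((1 - s) • y)‖ := norm_mul₃_le
      _ ≤ 1 * ‖x - y‖ * 1 := by gcongr
      _ = ‖x - y‖ := by ring
  have := norm_image_sub_le_of_norm_deriv_le_segment_01'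
    (fun s _ => (hd s).hasDerivWithinAt) hb
  simpa [f] using this

lemma skew_smul_mem {a : 𝒜} (ha : IsSelfAdjoint a) (t : ℝ) :
    (-(Complex.I * (t : ℂ))) • a ∈ skewAdjoint 𝒜 := by
  rw [skewAdjoint.mem_iff, star_smul, ha.star_eq, ← neg_smul]
  simp

/-- The rotations generated by two self-adjoint involutions are as close as the involutions. -/
lemma norm_exp_smul_involution_sub_le {a b : 𝒜} (ha : IsSelfAdjoint a) (hb : IsSelfAdjoint b)
    (ha2 : a * a = 1) (hb2 : b * b = 1) (t : ℝ) :
    ‖exp ((-(Complex.I * (t : ℂ))) • a) - exp ((-(Complex.I * (t : ℂ))) • b)‖ ≤ ‖a - b‖ := by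
  set z : ℂ := -(Complex.I * (t : ℂ))
  -- Since `a² = b² = 1`, the element `1 + ab` intertwines `b` with `a`, hence their exponentials.
  -- It is within `‖a - b‖` of `2`, so the bound does not depend on `t`.
  have hs : SemiconjBy (1 + a * b) (z • b) (z • a) := by
    simp only [SemiconjBy, mul_smul_comm, smul_mul_assoc, add_mul, mul_add, mul_assoc, hb2,
      ← mul_assoc a a, ha2]
    simp [add_comm]
  let := NormedAlgebra.restrictScalars ℚ ℂ 𝒜
  have he : (1 + a * b) * exp (z • b) = exp (z • a) * (1 + a * b) := hs.exp_right
  have hb1 : ‖b‖ ≤ 1 := norm_le_one_of_mem_unitary (by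
    simp [Unitary.mem_iff, hb.star_eq, hb2])
  have hW : ‖1 + a * b - 2‖ ≤ ‖a - b‖ := by
    have : 1 + a * b - 2 = (a - b) * b := by
      rw [sub_mul, hb2, ← one_add_one_eq_two]; abel
    rw [this]
    calc _ ≤ ‖a - b‖ * ‖b‖ := norm_mul_le _ _
      _ ≤ ‖a - b‖ * 1 := by gcongr
      _ = _ := mul_one _
  have ea := norm_exp_le_one_of_mem_skewAdjoint (skew_smul_mem ha t)
  have eb := norm_exp_le_one_of_mem_skewAdjoint (skew_smul_mem hb t)
  have key : (2 : ℝ) • (exp (z • a) - exp (z • b)) =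
      (1 + a * b - 2) * exp (z • b) - exp (z • a) * (1 + a * b - 2) := by
    rw [sub_mul, he, mul_sub, two_smul, ← one_add_one_eq_two]
    noncomm_ring
  have h2 : 2 * ‖exp (z • a) - exp (z • b)‖ ≤ 2 * ‖a - b‖ := by
    calc 2 * ‖exp (z • a) - exp (z • b)‖ = ‖(2 : ℝ) • (exp (z • a) - exp (z • b))‖ := by
          rw [norm_smul]; simp
      _ ≤ ‖1 + a * b - 2‖ * ‖exp (z • b)‖ + ‖exp (z • a)‖ * ‖1 + a * b - 2‖ := by
          rw [key]
          exact (norm_sub_le _ _).trans (add_le_add (norm_mul_le _ _) (norm_mul_le _ _))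
      _ ≤ ‖a - b‖ * 1 + 1 * ‖a - b‖ := by gcongr
      _ = 2 * ‖a - b‖ := by ring
  linarith

/-! ### Exponentials of vectors under a Clifford map. -/

section Clifford

variable {E : Type*} [NormedAddCommGroup E] [InnerProductSpace ℝ E] {S : E →ₗ[ℝ] 𝒜}

lemma norm_clifford [Nontrivial 𝒜] (hsa : ∀ v, IsSelfAdjoint (S v))
    (hsq : ∀ v, S v * S v = algebraMap ℝ 𝒜 (‖v‖ ^ 2)) (v : E) : ‖S v‖ = ‖v‖ := by
  have h : ‖S v‖ ^ 2 = ‖v‖ ^ 2 := by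
    rw [← (hsa v).norm_mul_self, hsq, norm_algebraMap']
    simp
  exact (sq_eq_sq₀ (norm_nonneg _) (norm_nonneg _)).1 h

lemma norm_exp_clifford_sub_le_smul [Nontrivial 𝒜] (hsa : ∀ v, IsSelfAdjoint (S v))
    (hsq : ∀ v, S v * S v = algebraMap ℝ 𝒜 (‖v‖ ^ 2)) (v w : E) {t : ℝ} (ht : 0 ≤ t) :
    ‖exp ((-(Complex.I * (t : ℂ))) • S v) - exp ((-(Complex.I * (t : ℂ))) • S w)‖
      ≤ t * ‖v - w‖ := by
  refine (norm_exp_sub_exp_le_of_mem_skewAdjoint (skew_smul_mem (hsa v) t)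
    (skew_smul_mem (hsa w) t)).trans_eq ?_
  rw [← smul_sub, ← map_sub, norm_smul, norm_clifford hsa hsq]
  simp [abs_of_nonneg ht]

/-- Separates direction from length: turning `v` to the direction of `w` at fixed length costs
nothing in `t`, and only the change of length is multiplied by `t`. -/
lemma norm_exp_clifford_sub_le [Nontrivial 𝒜] (hsa : ∀ v, IsSelfAdjoint (S v))
    (hsq : ∀ v, S v * S v = algebraMap ℝ 𝒜 (‖v‖ ^ 2)) {v w : E} (hv : v ≠ 0) (hw : w ≠ 0)
    {t : ℝ} (ht : 0 ≤ t) :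
    ‖exp ((-(Complex.I * (t : ℂ))) • S v) - exp ((-(Complex.I * (t : ℂ))) • S w)‖
      ≤ t * |‖v‖ - ‖w‖| + 2 * ‖v - w‖ / ‖v‖ := by
  have hv' : 0 < ‖v‖ := norm_pos_iff.2 hv
  have hw' : 0 < ‖w‖ := norm_pos_iff.2 hw
  have hunit : ∀ {x : E}, x ≠ 0 → S (‖x‖⁻¹ • x) * S (‖x‖⁻¹ • x) = 1 := by
    intro x hx
    rw [hsq, norm_smul, norm_inv, norm_norm, inv_mul_cancel₀ (norm_ne_zero_iff.2 hx)]
    simp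
  have hv1 := hunit hv
  have hw1 := hunit hw
  set v' := ‖v‖⁻¹ • v with hv'd
  set w' := ‖w‖⁻¹ • w with hw'd
  have hvv : v = ‖v‖ • v' := by rw [hv'd, smul_inv_smul₀ hv'.ne']
  have hww : w = ‖w‖ • w' := by rw [hw'd, smul_inv_smul₀ hw'.ne']
  have hn : ‖w'‖ = 1 := by rw [hw'd, norm_smul]; simp [hw'.ne']
  clear_value v' w'
  have h1 := norm_exp_smul_involution_sub_le (hsa v') (hsa w') hv1 hw1 (t * ‖v‖)
  have h2 := norm_exp_clifford_sub_le_smul hsa hsq (‖v‖ • w') w ht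
  have e1 : (-(Complex.I * ((t * ‖v‖ : ℝ) : ℂ))) • S v' = (-(Complex.I * (t : ℂ))) • S v := by
    conv_rhs => rw [hvv, map_smul, ← Complex.coe_smul, smul_smul]
    push_cast; congr 1; ring
  have e2 : (-(Complex.I * ((t * ‖v‖ : ℝ) : ℂ))) • S w' =
      (-(Complex.I * (t : ℂ))) • S (‖v‖ • w') := by
    rw [map_smul, ← Complex.coe_smul, smul_smul]
    push_cast; congr 1; ring
  rw [e1, e2, ← map_sub, norm_clifford hsa hsq] at h1
  have h3 : ‖‖v‖ • w' - w‖ = |‖v‖ - ‖w‖| := by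
    nth_rewrite 1 [hww]
    rw [← sub_smul, norm_smul, hn, mul_one, Real.norm_eq_abs]
  have h4 : ‖v' - w'‖ ≤ 2 * ‖v - w‖ / ‖v‖ := by
    rw [le_div_iff₀ hv']
    have : ‖v‖ • (v' - w') = (v - w) + (‖w‖ - ‖v‖) • w' := by
      rw [smul_sub, ← hvv, sub_smul, ← hww]; abel
    calc ‖v' - w'‖ * ‖v‖ = ‖‖v‖ • (v' - w')‖ := by rw [norm_smul, norm_norm, mul_comm]
      _ ≤ ‖v - w‖ + |‖w‖ - ‖v‖| := by
        rw [this]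
        refine (norm_add_le _ _).trans_eq ?_
        rw [norm_smul (‖w‖ - ‖v‖), hn, mul_one, Real.norm_eq_abs]
      _ ≤ ‖v - w‖ + ‖v - w‖ := by
        gcongr
        rw [abs_sub_comm]
        exact abs_norm_sub_norm_le v w
      _ = 2 * ‖v - w‖ := by ring
  rw [h3] at h2
  calc _ ≤ _ := norm_sub_le_norm_sub_add_norm_sub _ (exp ((-(Complex.I * (t : ℂ))) • S (‖v‖ • w'))) _
    _ ≤ _ := by linarith

/-- Two evolutions in the same static field: the field is what turns the angle between the two
unit vectors into a difference of frequencies. -/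
lemma norm_exp_clifford_field_sub_le [Nontrivial 𝒜] (hsa : ∀ v, IsSelfAdjoint (S v))
    (hsq : ∀ v, S v * S v = algebraMap ℝ 𝒜 (‖v‖ ^ 2)) {a b p : E} (ha : ‖a‖ = 1) (hb : ‖b‖ = 1)
    (hp : ‖p‖ = 1) {ν t : ℝ} (hν : 0 ≤ ν) (ht : 0 ≤ t) :
    ‖exp ((-(Complex.I * (t : ℂ))) • S (a + ν • p)) -
        exp ((-(Complex.I * (t : ℂ))) • S (b + ν • p))‖ ≤ (4 + 2 * ν * t) * ‖a - b‖ := by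
  rcases le_or_gt ν (1 / 2) with h | h
  -- For `ν ≤ 1/2` the field cannot cancel the unit vector, so both total vectors have length at
  -- least `1/2`.
  · have low : ∀ c : E, ‖c‖ = 1 → 1 / 2 ≤ ‖c + ν • p‖ := by
      intro c hc
      have := norm_sub_le_norm_add c (ν • p)
      rw [hc, norm_smul, hp, mul_one, Real.norm_of_nonneg hν] at this
      linarith
    have la := low a ha
    have lb := low b hb
    have hd : (a + ν • p) - (b + ν • p) = a - b := by abel
    have key := norm_exp_clifford_sub_le hsa hsq (v := a + ν • p) (w := b + ν • p)
      (norm_pos_iff.1 (by linarith)) (norm_pos_iff.1 (by linarith)) ht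
    rw [hd] at key
    -- As `‖a‖ = ‖b‖`, the squared lengths differ only by the cross term `2ν⟪a - b, p⟫`; dividing by
    -- the sum of lengths, at least `1`, gives the frequency gap.
    have h1 : |‖a + ν • p‖ - ‖b + ν • p‖| ≤ 2 * ν * ‖a - b‖ := by
      have sq : (‖a + ν • p‖ - ‖b + ν • p‖) * (‖a + ν • p‖ + ‖b + ν • p‖) =
          2 * ν * inner ℝ (a - b) p := by
        have e1 := norm_add_sq_real a (ν • p)
        have e2 := norm_add_sq_real b (ν • p)
        rw [inner_smul_right, ha] at e1
        rw [inner_smul_right, hb] at e2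
        rw [inner_sub_left]
        linear_combination e1 - e2
      have habs : |‖a + ν • p‖ - ‖b + ν • p‖| * (‖a + ν • p‖ + ‖b + ν • p‖) ≤
          2 * ν * ‖a - b‖ := by
        rw [← abs_of_nonneg (by positivity : 0 ≤ ‖a + ν • p‖ + ‖b + ν • p‖), ← abs_mul, sq,
          abs_mul, abs_of_nonneg (by positivity : 0 ≤ 2 * ν)]
        have := abs_real_inner_le_norm (a - b) p
        rw [hp, mul_one] at this
        gcongr
      refine le_trans ?_ habs
      exact le_mul_of_one_le_right (abs_nonneg _) (by linarith)
    have h2 : 2 * ‖a - b‖ / ‖a + ν • p‖ ≤ 4 * ‖a - b‖ := by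
      rw [div_le_iff₀ (by linarith)]
      nlinarith [norm_nonneg (a - b)]
    nlinarith [mul_le_mul_of_nonneg_left h1 ht]
  -- For a strong field the crude Duhamel bound suffices, because `t ≤ 2νt`.
  · have key := norm_exp_clifford_sub_le_smul hsa hsq (a + ν • p) (b + ν • p) ht
    rw [add_sub_add_right_eq_sub] at key
    have : t ≤ 4 + 2 * ν * t := by nlinarith
    exact key.trans (by gcongr)

end Clifford

end CStar

/-! ### Pauli matrices and Bloch vectors. -/

open scoped Matrix.Norms.L2Operator

/-- `pauliDot` as a linear map on Euclidean space. -/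
noncomputable def pauliMap : EuclideanSpace ℝ (Fin 3) →ₗ[ℝ] Matrix (Fin 2) (Fin 2) ℂ where
  toFun v := pauliDot v
  map_add' v w := by
    simp only [pauliDot, PiLp.add_apply, Complex.ofReal_add]; module
  map_smul' r v := by
    simp only [pauliDot, PiLp.smul_apply, smul_eq_mul, Complex.ofReal_mul, RingHom.id_apply,
      ← Complex.coe_smul]
    module

lemma pauliMap_apply (v : EuclideanSpace ℝ (Fin 3)) :
    pauliMap v = !![(v 2 : ℂ), v 0 - v 1 * Complex.I; v 0 + v 1 * Complex.I, -(v 2 : ℂ)] := by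
  change pauliDot v = _
  ext i j
  fin_cases i <;> fin_cases j <;> simp [pauliDot, pauliX, pauliY, pauliZ, sub_eq_add_neg]

lemma isSelfAdjoint_pauliMap (v : EuclideanSpace ℝ (Fin 3)) : IsSelfAdjoint (pauliMap v) := by
  rw [IsSelfAdjoint, pauliMap_apply]
  ext i j
  fin_cases i <;> fin_cases j <;> simp [sub_eq_add_neg]

lemma pauliMap_mul_self (v : EuclideanSpace ℝ (Fin 3)) :
    pauliMap v * pauliMap v = algebraMap ℝ (Matrix (Fin 2) (Fin 2) ℂ) (‖v‖ ^ 2) := by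
  rw [EuclideanSpace.real_norm_sq_eq, Fin.sum_univ_three, pauliMap_apply]
  have hI := Complex.I_mul_I
  ext i j
  fin_cases i <;> fin_cases j <;>
    simp [Matrix.mul_apply, Fin.sum_univ_two, Matrix.algebraMap_matrix_apply] <;>
    first | ring1 | linear_combination (-(v 1 : ℂ) ^ 2) * hI

lemma exists_pauliMap_eq {P : Matrix (Fin 2) (Fin 2) ℂ} (hP : P.IsHermitian)
    (htr : P.trace = 0) : ∃ p, P = pauliMap p := by
  refine ⟨!₂[(P 1 0).re, (P 1 0).im, (P 0 0).re], ?_⟩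
  have h00 := hP.apply 0 0
  have h01 := hP.apply 0 1
  rw [Matrix.trace_fin_two] at htr
  have h0 : ((P 0 0).re : ℂ) = P 0 0 := Complex.conj_eq_iff_re.1 h00
  have h1 : ((P 1 0).re : ℂ) + (P 1 0).im * Complex.I = P 1 0 := Complex.re_add_im _
  have h2 : ((P 1 0).re : ℂ) - (P 1 0).im * Complex.I = P 0 1 := by
    rw [← h01, Complex.star_def]
    apply Complex.ext <;> simp
  rw [pauliMap_apply]
  ext i j
  fin_cases i <;> fin_cases j
  · simp [h0]
  · simp [h2]
  · simp [h1]
  · simp [h0, eq_neg_of_add_eq_zero_right htr]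

lemma norm_eq_one_of_pauliMap_mul_self {p : EuclideanSpace ℝ (Fin 3)}
    (h : pauliMap p * pauliMap p = 1) : ‖p‖ = 1 := by
  rw [pauliMap_mul_self, map_eq_one_iff _ (algebraMap ℝ _).injective] at h
  exact (pow_eq_one_iff_of_nonneg (norm_nonneg p) two_ne_zero).1 h

/-- The Bloch vectors of the two candidates. -/
noncomputable def blochVector (ε : ℝ) : Bool → EuclideanSpace ℝ (Fin 3)
  | false => !₂[0, 0, 1]
  | true => (Real.sqrt (1 + ε ^ 2))⁻¹ • !₂[ε, 0, 1]

lemma candidate_eq_pauliMap (ε : ℝ) (b : Bool) : candidate ε b = pauliMap (blochVector ε b) := by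
  cases b
  · change pauliZ = _
    rw [pauliMap_apply]
    simp [pauliZ, blochVector]
  · rfl

lemma norm_blochVector (ε : ℝ) (b : Bool) : ‖blochVector ε b‖ = 1 := by
  have h : 0 < 1 + ε ^ 2 := by positivity
  rw [← sq_eq_sq₀ (norm_nonneg _) zero_le_one, EuclideanSpace.real_norm_sq_eq,
    Fin.sum_univ_three]
  cases b
  · simp [blochVector]
  · simp [blochVector, mul_pow, inv_pow, Real.sq_sqrt h.le]
    field_simp
    ring

lemma norm_blochVector_true_sub_false_le {ε : ℝ} (hε : 0 ≤ ε) :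
    ‖blochVector ε true - blochVector ε false‖ ≤ ε := by
  have h : 0 < 1 + ε ^ 2 := by positivity
  set s := Real.sqrt (1 + ε ^ 2) with hs
  have hs2 : s ^ 2 = 1 + ε ^ 2 := Real.sq_sqrt h.le
  have hs1 : 1 ≤ s := Real.one_le_sqrt.2 (by nlinarith)
  have key : s⁻¹ ^ 2 * s ^ 2 = 1 := by rw [← mul_pow, inv_mul_cancel₀ (by linarith), one_pow]
  have hinv : s⁻¹ * s = 1 := inv_mul_cancel₀ (by linarith)
  rw [← sq_le_sq₀ (norm_nonneg _) hε, EuclideanSpace.real_norm_sq_eq, Fin.sum_univ_three]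
  simp only [blochVector, PiLp.sub_apply, PiLp.smul_apply, smul_eq_mul]
  simp only [Matrix.cons_val, ← hs]
  have hi : 0 ≤ s⁻¹ := by positivity
  -- The left side is the squared distance of the two unit vectors, and `s² - 1 = ε²`.
  have : 2 * (1 - s⁻¹) ≤ s ^ 2 - 1 := by
    have h1 : (1 - s⁻¹) ≤ s - 1 := by nlinarith [mul_nonneg hi (sq_nonneg (s - 1))]
    nlinarith
  nlinarith

lemma norm_blochVector_sub_le {ε : ℝ} (hε : 0 ≤ ε) (b b' : Bool) :
    ‖blochVector ε b - blochVector ε b'‖ ≤ ε := by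
  cases b <;> cases b'
  · simpa using hε
  · rw [norm_sub_rev]; exact norm_blochVector_true_sub_false_le hε
  · exact norm_blochVector_true_sub_false_le hε
  · simpa using hε

/-! ### Ancillas, segments and whole experiments. -/

section Kronecker

variable (m n : Type*) [Fintype m] [DecidableEq m] [Fintype n] [DecidableEq n]

/-- `A ↦ A ⊗ I` as a `⋆`-homomorphism. -/
noncomputable def kroneckerOneHom : Matrix m m ℂ →⋆ₐ[ℂ] Matrix (m × n) (m × n) ℂ where
  toFun A := A ⊗ₖ (1 : Matrix n n ℂ)
  map_one' := Matrix.one_kronecker_one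
  map_mul' A B := by rw [← Matrix.mul_kronecker_mul, one_mul]
  map_zero' := Matrix.zero_kronecker _
  map_add' A B := Matrix.add_kronecker _ _ _
  commutes' r := by
    simp only [Algebra.algebraMap_eq_smul_one, Matrix.smul_kronecker, Matrix.one_kronecker_one]
  map_star' A := by
    simp [Matrix.star_eq_conjTranspose, Matrix.conjTranspose_kronecker]

/-- Star homomorphisms of C*-algebras are contractive, so ancillas do not amplify the difference. -/
lemma norm_kronecker_one_le (A : Matrix m m ℂ) : ‖A ⊗ₖ (1 : Matrix n n ℂ)‖ ≤ ‖A‖ :=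
  NonUnitalStarAlgHom.norm_apply_le (kroneckerOneHom m n) A

end Kronecker

lemma norm_le_one_of_mem_unitaryGroup {n : Type*} [Fintype n] [DecidableEq n]
    (U : Matrix.unitaryGroup n ℂ) : ‖(U : Matrix n n ℂ)‖ ≤ 1 :=
  norm_le_one_of_mem_unitary U.2

namespace Segment

variable {n : ℕ}

lemma op_mem_unitary (s : Segment n) {H : Matrix (Fin 2) (Fin 2) ℂ} (hH : H.IsHermitian) :
    s.op H ∈ unitary (Matrix (Register n) (Register n) ℂ) := by
  let := NormedAlgebra.restrictScalars ℚ ℂ (Matrix (Fin 2) (Fin 2) ℂ)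
  have hs : IsSelfAdjoint (H + (s.strength : ℂ) • s.direction) := by
    have h1 : IsSelfAdjoint H := hH
    have h2 : IsSelfAdjoint s.direction := s.direction_isHermitian
    refine h1.add (IsSelfAdjoint.smul ?_ h2)
    simp [IsSelfAdjoint]
  exact mul_mem s.gate.2 (Unitary.map_mem (kroneckerOneHom _ _)
    (exp_mem_unitary_of_mem_skewAdjoint (skew_smul_mem hs s.time)))

lemma norm_op_sub_op_le (s : Segment n) {ε ν : ℝ} (hε : 0 ≤ ε) (hν : s.strength ≤ ν)
    (b b' : Bool) :
    ‖s.op (candidate ε b) - s.op (candidate ε b')‖ ≤ (4 + 2 * ν * s.time) * ε := by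
  obtain ⟨p, hp⟩ := exists_pauliMap_eq s.direction_isHermitian s.direction_trace
  have hp1 : ‖p‖ = 1 := norm_eq_one_of_pauliMap_mul_self (hp ▸ s.direction_sq)
  have hν0 := s.strength_nonneg
  have ht := s.time_nonneg
  have hH : ∀ c, candidate ε c + (s.strength : ℂ) • s.direction =
      pauliMap (blochVector ε c + s.strength • p) := by
    intro c
    rw [candidate_eq_pauliMap, hp, map_add, map_smul, Complex.coe_smul]
  rw [op, op, ← mul_sub, hH, hH, sub_eq_add_neg, ← neg_one_smul ℂ (_ ⊗ₖ _),
    ← Matrix.smul_kronecker, ← Matrix.add_kronecker, neg_one_smul, ← sub_eq_add_neg]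
  refine (norm_mul_le _ _).trans ?_
  refine (mul_le_of_le_one_left (norm_nonneg _) (norm_le_one_of_mem_unitaryGroup _)).trans ?_
  refine (norm_kronecker_one_le _ _ _).trans ?_
  refine (norm_exp_clifford_field_sub_le isSelfAdjoint_pauliMap pauliMap_mul_self
    (norm_blochVector ε b) (norm_blochVector ε b') hp1 hν0 ht).trans ?_
  have := norm_blochVector_sub_le hε b b'
  have : 0 ≤ ν := hν0.trans hν
  gcongr

end Segment

lemma isHermitian_candidate (ε : ℝ) (b : Bool) : (candidate ε b).IsHermitian := by
  rw [candidate_eq_pauliMap]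
  exact isSelfAdjoint_pauliMap _

namespace Experiment

lemma foldl_op_mem_unitary {n : ℕ} {H : Matrix (Fin 2) (Fin 2) ℂ} (hH : H.IsHermitian)
    (l : List (Segment n)) {V : Matrix (Register n) (Register n) ℂ} (hV : V ∈ unitary _) :
    l.foldl (fun V s => s.op H * V) V ∈ unitary _ := by
  induction l generalizing V with
  | nil => exact hV
  | cons s l ih => exact ih (mul_mem (s.op_mem_unitary hH) hV)

lemma evolution_mem_unitary (E : Experiment) {H : Matrix (Fin 2) (Fin 2) ℂ}
    (hH : H.IsHermitian) : E.evolution H ∈ unitary _ :=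
  foldl_op_mem_unitary hH _ E.initialGate.2

lemma norm_foldl_op_sub_le {n : ℕ} {ε ν : ℝ} (hε : 0 ≤ ε) (b b' : Bool) (l : List (Segment n))
    (hl : ∀ s ∈ l, s.strength ≤ ν) {V W : Matrix (Register n) (Register n) ℂ}
    (hV : V ∈ unitary _) (hW : W ∈ unitary _) :
    ‖l.foldl (fun V s => s.op (candidate ε b) * V) V -
        l.foldl (fun V s => s.op (candidate ε b') * V) W‖ ≤
      ‖V - W‖ + (4 * l.length + 2 * ν * (l.map Segment.time).sum) * ε := by
  induction l generalizing V W with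
  | nil => simp
  | cons s l ih =>
    have hu := s.op_mem_unitary (isHermitian_candidate ε b)
    have hu' := s.op_mem_unitary (isHermitian_candidate ε b')
    have h := ih (fun s hs => hl s (List.mem_cons_of_mem _ hs)) (mul_mem hu hV) (mul_mem hu' hW)
    have hs := s.norm_op_sub_op_le hε (hl s List.mem_cons_self) b b'
    have hstep : ‖s.op (candidate ε b) * V - s.op (candidate ε b') * W‖ ≤
        ‖V - W‖ + (4 + 2 * ν * s.time) * ε := by
      -- Change one factor at a time; each difference is multiplied by a unitary, so errors add.
      have : s.op (candidate ε b) * V - s.op (candidate ε b') * W =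
          s.op (candidate ε b) * (V - W) +
            (s.op (candidate ε b) - s.op (candidate ε b')) * W := by
        noncomm_ring
      rw [this]
      refine (norm_add_le _ _).trans (add_le_add ?_ ?_)
      · exact (norm_mul_le _ _).trans
          (mul_le_of_le_one_left (norm_nonneg _) (norm_le_one_of_mem_unitary hu))
      · exact ((norm_mul_le _ _).trans
          (mul_le_of_le_one_right (norm_nonneg _) (norm_le_one_of_mem_unitary hW))).trans hs
    simp only [List.foldl_cons, List.length_cons, List.map_cons, List.sum_cons, Nat.cast_add,
      Nat.cast_one]
    linarith

lemma norm_evolution_sub_le (E : Experiment) {ε ν : ℝ} (hε : 0 ≤ ε) (b b' : Bool)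
    (hE : ∀ s ∈ E.segments, s.strength ≤ ν) :
    ‖E.evolution (candidate ε b) - E.evolution (candidate ε b')‖ ≤
      (4 * E.applications + 2 * ν * E.totalTime) * ε := by
  have h := norm_foldl_op_sub_le hε b b' E.segments hE E.initialGate.2 E.initialGate.2
  rwa [sub_self, norm_zero, zero_add] at h

end Experiment

/-! ### Born probabilities. -/

open scoped MatrixOrder

section Born

variable {n : Type*} [Fintype n] [DecidableEq n]

lemma star_dotProduct_mulVec_eq_inner (A : Matrix n n ℂ) (v w : n → ℂ) :
    star v ⬝ᵥ (A *ᵥ w) =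
      inner ℂ (WithLp.toLp 2 v) (Matrix.toEuclideanCLM (n := n) (𝕜 := ℂ) A (WithLp.toLp 2 w)) := by
  rw [Matrix.toEuclideanCLM_toLp, EuclideanSpace.inner_toLp_toLp, dotProduct_comm]

lemma norm_toLp_mulVec_le (A : Matrix n n ℂ) (v : n → ℂ) :
    ‖WithLp.toLp 2 (A *ᵥ v)‖ ≤ ‖A‖ * ‖WithLp.toLp 2 v‖ :=
  A.l2_opNorm_mulVec (WithLp.toLp 2 v)

lemma abs_re_quadratic_sub_le {F : Matrix n n ℂ} (hF : ‖F‖ ≤ 1) {v w : n → ℂ}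
    (hv : ‖WithLp.toLp 2 v‖ ≤ 1) (hw : ‖WithLp.toLp 2 w‖ ≤ 1) :
    |(star v ⬝ᵥ (F *ᵥ v)).re - (star w ⬝ᵥ (F *ᵥ w)).re| ≤ 2 * ‖WithLp.toLp 2 (v - w)‖ := by
  rw [star_dotProduct_mulVec_eq_inner, star_dotProduct_mulVec_eq_inner, WithLp.toLp_sub]
  set x : EuclideanSpace ℂ n := WithLp.toLp 2 v
  set y : EuclideanSpace ℂ n := WithLp.toLp 2 w
  set T := Matrix.toEuclideanCLM (n := n) (𝕜 := ℂ) F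
  have hT : ∀ z, ‖T z‖ ≤ ‖z‖ := fun z =>
    (T.le_opNorm z).trans (mul_le_of_le_one_left (norm_nonneg _) hF)
  have e : inner ℂ x (T x) - inner ℂ y (T y) = inner ℂ (x - y) (T x) + inner ℂ y (T (x - y)) := by
    simp
  rw [← Complex.sub_re, e]
  calc _ ≤ ‖inner ℂ (x - y) (T x) + inner ℂ y (T (x - y))‖ := Complex.abs_re_le_norm _
    _ ≤ ‖x - y‖ * ‖T x‖ + ‖y‖ * ‖T (x - y)‖ :=
      (norm_add_le _ _).trans (add_le_add (norm_inner_le_norm _ _) (norm_inner_le_norm _ _))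
    _ ≤ ‖x - y‖ * 1 + 1 * ‖x - y‖ := by
      gcongr
      · exact (hT x).trans hv
      · exact hT _
    _ = 2 * ‖x - y‖ := by ring

end Born

namespace Experiment

variable (E : Experiment) {H : Matrix (Fin 2) (Fin 2) ℂ}

lemma norm_state : ‖WithLp.toLp 2 E.state‖ = 1 := by
  rw [EuclideanSpace.norm_eq, E.state_unit, Real.sqrt_one]

lemma norm_finalState_le (hH : H.IsHermitian) : ‖WithLp.toLp 2 (E.finalState H)‖ ≤ 1 := by
  refine (norm_toLp_mulVec_le _ _).trans ?_
  rw [norm_state, mul_one]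
  exact norm_le_one_of_mem_unitary (E.evolution_mem_unitary hH)

lemma prob_nonneg (i : Fin E.outcomes) : 0 ≤ E.prob H i :=
  (Complex.nonneg_iff.1 ((E.povm_posSemidef i).dotProduct_mulVec_nonneg _)).1

lemma sum_prob (hH : H.IsHermitian) : ∑ i, E.prob H i = 1 := by
  have h : (star (E.finalState H) ⬝ᵥ E.finalState H) = 1 := by
    have hU : star (E.evolution H) * E.evolution H = 1 := (E.evolution_mem_unitary hH).1
    rw [finalState, Matrix.star_mulVec, ← Matrix.dotProduct_mulVec, Matrix.mulVec_mulVec,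
      ← Matrix.star_eq_conjTranspose, hU, Matrix.one_mulVec]
    have := E.state_unit
    simp only [dotProduct, Pi.star_apply, RCLike.star_def, Complex.conj_mul']
    exact_mod_cast congrArg (fun r : ℝ => (r : ℂ)) this
  simp only [prob]
  rw [← Complex.re_sum, ← dotProduct_sum, ← Matrix.sum_mulVec, E.povm_sum, Matrix.one_mulVec, h,
    Complex.one_re]

lemma sum_prob_mul_eq (f : Fin E.outcomes → ℝ) :
    ∑ i, E.prob H i * f i =
      (star (E.finalState H) ⬝ᵥ ((∑ i, (f i : ℂ) • E.povm i) *ᵥ E.finalState H)).re := by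
  rw [Matrix.sum_mulVec, dotProduct_sum, Complex.re_sum]
  refine Finset.sum_congr rfl fun i _ => ?_
  rw [Matrix.smul_mulVec, dotProduct_smul, smul_eq_mul, Complex.re_ofReal_mul, mul_comm, prob]

/-- Weights in `[0, 1]` give `0 ≤ ∑ fᵢMᵢ ≤ ∑ Mᵢ = 1`. -/
lemma norm_sum_smul_povm_le {f : Fin E.outcomes → ℝ} (h0 : ∀ i, 0 ≤ f i) (h1 : ∀ i, f i ≤ 1) :
    ‖∑ i, (f i : ℂ) • E.povm i‖ ≤ 1 := by
  have hp : ∀ i, 0 ≤ E.povm i := fun i => Matrix.nonneg_iff_posSemidef.2 (E.povm_posSemidef i)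
  have smul_nonneg' : ∀ (i) {r : ℝ}, 0 ≤ r → 0 ≤ (r : ℂ) • E.povm i := fun i r hr =>
    Matrix.nonneg_iff_posSemidef.2 ((E.povm_posSemidef i).smul (by exact_mod_cast hr))
  rw [CStarAlgebra.norm_le_one_iff_of_nonneg _ (Finset.sum_nonneg fun i _ => smul_nonneg' i (h0 i)),
    ← E.povm_sum]
  refine Finset.sum_le_sum fun i _ => ?_
  have := smul_nonneg' i (sub_nonneg.2 (h1 i))
  rw [Complex.ofReal_sub, sub_smul, Complex.ofReal_one, one_smul] at this
  exact sub_nonneg.1 this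

/-- The average of `f` is the quadratic form of a single contraction, so the bound is independent of
the number of outcomes. -/
lemma abs_sum_prob_mul_sub_le {ε ν : ℝ} (hε : 0 ≤ ε) (b b' : Bool)
    (hE : ∀ s ∈ E.segments, s.strength ≤ ν) {f : Fin E.outcomes → ℝ}
    (h0 : ∀ i, 0 ≤ f i) (h1 : ∀ i, f i ≤ 1) :
    |∑ i, E.prob (candidate ε b) i * f i - ∑ i, E.prob (candidate ε b') i * f i| ≤
      8 * ε * E.applications + 4 * ν * ε * E.totalTime := by
  rw [sum_prob_mul_eq, sum_prob_mul_eq]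
  refine (abs_re_quadratic_sub_le (E.norm_sum_smul_povm_le h0 h1)
    (E.norm_finalState_le (isHermitian_candidate ε b))
    (E.norm_finalState_le (isHermitian_candidate ε b'))).trans ?_
  have h := norm_toLp_mulVec_le
    (E.evolution (candidate ε b) - E.evolution (candidate ε b')) E.state
  rw [norm_state, mul_one, Matrix.sub_mulVec] at h
  have := h.trans (E.norm_evolution_sub_le hε b b' hE)
  simp only [finalState]
  linarith

end Experiment

/-! ### The hybrid argument on the tree. -/

namespace Protocol

lemma guessProb_nonneg (H : Matrix (Fin 2) (Fin 2) ℂ) (g : Bool) (A : Protocol) :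
    0 ≤ A.guessProb H g := by
  induction A with
  | leaf b => rw [guessProb]; split_ifs <;> norm_num
  | node E next ih =>
    exact Finset.sum_nonneg fun i _ => mul_nonneg (E.prob_nonneg i) (ih i)

lemma guessProb_true_add_false {H : Matrix (Fin 2) (Fin 2) ℂ} (hH : H.IsHermitian)
    (A : Protocol) : A.guessProb H true + A.guessProb H false = 1 := by
  induction A with
  | leaf b => cases b <;> simp [guessProb]
  | node E next ih =>
    simp only [guessProb, ← Finset.sum_add_distrib, ← mul_add, ih, mul_one]
    exact E.sum_prob hH

lemma guessProb_le_one {H : Matrix (Fin 2) (Fin 2) ℂ} (hH : H.IsHermitian) (g : Bool)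
    (A : Protocol) : A.guessProb H g ≤ 1 := by
  have h := guessProb_true_add_false hH A
  have h1 := guessProb_nonneg H true A
  have h2 := guessProb_nonneg H false A
  cases g <;> linarith

/-- The hybrid argument: the two candidates are told apart only as far as the applications
and the expected evolution time allow. -/
lemma abs_guessProb_sub_le {ε ν : ℝ} (hε : 0 ≤ ε) (b b' g : Bool) (A : Protocol)
    (hA : A.FieldAtMost ν) :
    |A.guessProb (candidate ε b) g - A.guessProb (candidate ε b') g| ≤
      8 * ε * A.maxApplications + 4 * ν * ε * A.expectedTime (candidate ε b) := by
  induction A with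
  | leaf a => simp [guessProb, maxApplications, expectedTime]
  | node E next ih =>
    have hH := isHermitian_candidate ε b
    set M := Finset.univ.sup fun i => maxApplications (next i) with hM
    -- The intermediate hybrid runs the root under `b` and the subtrees under `b'`. Weighting
    -- subtrees by the probabilities under `b` makes their times sum to the expectation under `b`.
    have hdiff := E.abs_sum_prob_mul_sub_le hε b b' hA.1
      (f := fun i => guessProb (candidate ε b') g (next i))
      (fun i => guessProb_nonneg _ _ _)
      (fun i => guessProb_le_one (isHermitian_candidate ε b') _ _)
    have hchild : |∑ i, E.prob (candidate ε b) i * guessProb (candidate ε b) g (next i) -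
        ∑ i, E.prob (candidate ε b) i * guessProb (candidate ε b') g (next i)| ≤
        8 * ε * M + 4 * ν * ε *
          ∑ i, E.prob (candidate ε b) i * expectedTime (candidate ε b) (next i) := by
      rw [← Finset.sum_sub_distrib]
      calc _ ≤ ∑ i, E.prob (candidate ε b) i *
            (8 * ε * M + 4 * ν * ε * expectedTime (candidate ε b) (next i)) := by
            refine (Finset.abs_sum_le_sum_abs _ _).trans (Finset.sum_le_sum fun i _ => ?_)
            rw [← mul_sub, abs_mul, abs_of_nonneg (E.prob_nonneg i)]
            refine mul_le_mul_of_nonneg_left ((ih i (hA.2 i)).trans ?_) (E.prob_nonneg i)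
            have : maxApplications (next i) ≤ M :=
              Finset.le_sup (f := fun i => maxApplications (next i)) (Finset.mem_univ i)
            gcongr
        _ = 8 * ε * M + 4 * ν * ε *
            ∑ i, E.prob (candidate ε b) i * expectedTime (candidate ε b) (next i) := by
            simp only [mul_add, Finset.sum_add_distrib, ← Finset.sum_mul, E.sum_prob hH, one_mul]
            rw [Finset.mul_sum]
            congr 1
            exact Finset.sum_congr rfl fun i _ => by ring
    simp only [guessProb, maxApplications, expectedTime, ← hM]
    push_cast
    calc _ ≤ _ := abs_sub_le _
          (∑ i, E.prob (candidate ε b) i * guessProb (candidate ε b') g (next i)) _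
      _ ≤ _ := by linarith

end Protocol

end HamiltonianDiscrimination

open HamiltonianDiscrimination

/-! ### The lower bound. -/

theorem theoremS6 (q : ℝ) (hq : 1 / 2 < q) :
    ∃ c : ℝ, 0 < c ∧
      ∀ L : ℝ → ℕ, (fun ε : ℝ => (L ε : ℝ)) =o[𝓝[>] (0 : ℝ)] (fun ε : ℝ => 1 / ε) →
        ∀ᶠ ε : ℝ in 𝓝[>] (0 : ℝ), ∀ ν : ℝ, 0 ≤ ν → ν < 1 →
          ∀ A : HamiltonianDiscrimination.Protocol,
            A.FieldAtMost ν →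
            A.maxApplications ≤ L ε →
            (∀ b : Bool, q ≤ A.guessProb (HamiltonianDiscrimination.candidate ε b) b) →
            ∀ b : Bool, c / (4 * ν * ε + 3 * ε ^ 2) ≤
              A.expectedTime (HamiltonianDiscrimination.candidate ε b) := by
  refine ⟨(2 * q - 1) / 2, by linarith, fun L hL => ?_⟩
  -- Chosen so that `8εL(ε)` uses up at most half of the bias `2q - 1`.
  have hc : 0 < (2 * q - 1) / 16 := by linarith
  filter_upwards [hL.bound hc, self_mem_nhdsWithin] with ε hLε hε ν hν _ A hA hAL hguess b
  have hε : 0 < ε := hε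
  have hLε' : 8 * ε * A.maxApplications ≤ (2 * q - 1) / 2 := by
    rw [Real.norm_of_nonneg (by positivity), Real.norm_of_nonneg (by positivity),
      mul_one_div, le_div_iff₀ hε] at hLε
    have : (A.maxApplications : ℝ) ≤ L ε := by exact_mod_cast hAL
    nlinarith
  have hdiff := Protocol.abs_guessProb_sub_le hε.le b (!b) b A hA
  have hsum := Protocol.guessProb_true_add_false (isHermitian_candidate ε (!b)) A
  have h1 := hguess b
  have h2 := hguess (!b)
  have h3 : A.guessProb (candidate ε b) b - A.guessProb (candidate ε (!b)) b ≥ 2 * q - 1 := by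
    cases b <;> simp only [Bool.not_true, Bool.not_false] at * <;> linarith
  have h4 := (le_abs_self _).trans hdiff
  have h5 : (2 * q - 1) / 2 ≤ 4 * ν * ε * A.expectedTime (candidate ε b) := by linarith
  -- Needed because the `3ε²` in the denominator only weakens the bound when the time is
  -- nonnegative.
  have h6 : 0 ≤ A.expectedTime (candidate ε b) := by
    by_contra! hneg
    have : 4 * ν * ε * A.expectedTime (candidate ε b) ≤ 0 :=
      mul_nonpos_of_nonneg_of_nonpos (by positivity) hneg.le
    linarith
  rw [div_le_iff₀ (by positivity)]
  nlinarith [mul_nonneg h6 (sq_nonneg ε)]
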